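/- **Setting.** Let $d\ge 1$. For vectors, powers, maxima and $\le$ are coordinatewise; $x\oplus y=\max(x,y)$, $x\odot y=\min(x,y)$. Put $E_0=[0,\infty)^d\setminus\{0\}$, $E_0^*=(0,\infty)^d$. Fix a norm $\|\cdot\|$ on $\mathbb R^d$ such that $\mathbb S_+^{d-1}=\{x\in\mathbb R_+^d:\|x\|=1\}\subseteq[0,1]^d$, and let $\nu$ be a finite Borel measure on $\mathbb S_+^{d-1}$ with $\int u^j\,d\nu(u)=1$ for $j=1,\dots,d$. For $\alpha>0$ let $\mu_\alpha$ be the image of $\rho_1\otimes\nu$ under $(r,u)\mapsto (ru)^{1/\alpha}$, where $\rho_1$ is the measure on $(0,\infty)$ with $\rho_1[x,\infty)=1/x$. Write $Z\sim\mathcal{MS}(\alpha,\nu)$ if $Z$ has the distribution of $\bigoplus_{i\ge1}y_i$, where $(y_i)_{i\ge1}$ are the points of a Poisson process on $E_0$ with intensity measure $\mu_\alpha$ (the exponent measure). Write $Z\sim\mathcal F(\alpha)$ if $\mathbb P(Z\le x)=e^{-x^{-\alpha}}$ for $x>0$ and $0$ for $x\le 0$. Let $$d_K(X,Y)=\sup_{z\in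 E_0^*}|\mathbb P(X\le z)-\mathbb P(Y\le z)|,\qquad d_W(X,Y)=\sup_{h\in\mathrm{Lip}_1(\mathbb R_+^d)}|\mathbb E h(X)-\mathbb E h(Y)|,$$ where $\mathrm{Lip}_1(\mathbb R_+^d)$ is the set of $h:\mathbb R_+^d\to\mathbb R$ with $|h(x)-h(y)|\le\sum_j|x^j-y^j|$ for all $x,y\in\mathbb R_+^d$; the smooth Wasserstein distance is the same supremum over $\mathcal C^1(\mathbb R_+^d)\cap \mathrm{Lip}_1(\mathbb R_+^d)$. **Proposition.** Let $0<\alpha_1<\alpha_2$, let $Z_i\sim\mathcal{MS}(\alpha_i,\nu)$ for $i=1,2$ be random vectors, and let $Y\sim\mathcal F(\alpha_1)$ be a random variable. 1. The integrals in $$C^K=d+\sum_{j=1}^d\int_{E_0}|\log y^j|\;\mathbb P\big(Y^{\alpha_2/\alpha_1}\odot Y\le y^j\big)\,d\mu_{\alpha_1}(y)$$ are finite (the integrand being $0$ where $y^j=0$), and $$d_K(Z_1,Z_2)\le C^K\Big(\frac1{\alpha_1}+\frac1{\alpha_2}\Big)|\alpha_1-\alpha_2|.$$ 2. If moreover $\alpha_1,\alpha_2>1$,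 then the integrals in $$C^W=d\,\Gamma\Big(1-\frac1{\alpha_1}\Big)+\sum_{j=1}^d\int_{E_0}(1\oplus y^j)\,|\log y^j|\;\mathbb P\big(Y^{\alpha_2/\alpha_1}\odot Y\le y^j\big)\,d\mu_{\alpha_1}(y)$$ are finite, $C^W>0$, $h(Z_1)$ and $h(Z_2)$ are integrable for every $h\in\mathrm{Lip}_1(\mathbb R_+^d)$, and $$d_W(Z_1,Z_2)\le C^W\Big(\frac1{\alpha_1}+\frac1{\alpha_2}\Big)|\alpha_1-\alpha_2|;$$ the same bound therefore holds for the smooth Wasserstein distance. -/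

import Mathlib

open MeasureTheory ProbabilityTheory Set
open scoped ENNReal

noncomputable section

namespace MaxStable

/-! ### Sets of vectors -/

/-- The closed positive orthant of `ℝ^d`. -/
def orthant (d : ℕ) : Set (Fin d → ℝ) := {x | ∀ j, 0 ≤ x j}

/-- The punctured orthant `E₀ = [0, ∞) \ {0}`. -/
def E0 (d : ℕ) : Set (Fin d → ℝ) := {x | (∀ j, 0 ≤ x j) ∧ x ≠ 0}

/-- The open orthant `E₀* = (0, ∞)`. -/
def E0star (d : ℕ) : Set (Fin d → ℝ) := {x | ∀ j, 0 < x j}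

/-- The positive part of the unit sphere of a norm `N`. -/
def posSphere {d : ℕ} (N : Seminorm ℝ (Fin d → ℝ)) : Set (Fin d → ℝ) :=
  {x | (∀ j, 0 ≤ x j) ∧ N x = 1}

/-- `N` is an admissible reference norm on `ℝ^d`: it separates points (so that it is a norm), and
its positive unit sphere is contained in `[0, 1]^d`. -/
structure IsReferenceNorm {d : ℕ} (N : Seminorm ℝ (Fin d → ℝ)) : Prop where
  definite : ∀ x, N x = 0 → x = 0
  sphere_le_one : ∀ x ∈ posSphere N, ∀ j, x j ≤ 1

/-! ### Angular measures and exponent measures -/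

/-- The moment constraints `∫ u^j dν(u) = 1` for all `j`. -/
def MomentConstraints {d : ℕ} {N : Seminorm ℝ (Fin d → ℝ)} (ν : Measure (posSphere N)) : Prop :=
  ∀ j, ∫ u, (u : Fin d → ℝ) j ∂ν = 1

/-- The measure `ρ_α` on `(0, ∞)`, with density `α r^{-(α + 1)}`, so that
`ρ_α [x, ∞) = x^{-α}` for `x > 0`. -/
def rho (α : ℝ) : Measure ℝ :=
  (volume.restrict (Ioi 0)).withDensity fun r => ENNReal.ofReal (α * r ^ (-(α + 1)))

/-- The exponent measure of `MS(α, ν)`: the image of `ρ_1 ⊗ ν` under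
`(r, u) ↦ (r u)^{1/α}` (powers are taken coordinatewise). -/
def exponentMeasure {d : ℕ} {N : Seminorm ℝ (Fin d → ℝ)} (α : ℝ) (ν : Measure (posSphere N)) :
    Measure (Fin d → ℝ) :=
  ((rho 1).prod ν).map fun p => fun j => (p.1 * (p.2 : Fin d → ℝ) j) ^ (1 / α)

/-! ### Poisson processes -/

/-- The number of indices `i` such that `y i ω ∈ B`. -/
def pointCount {Ω E : Type*} (y : ℕ → Ω → E) (B : Set E) (ω : Ω) : ℝ≥0∞ :=
  ∑' i, B.indicator (fun _ => (1 : ℝ≥0∞)) (y i ω)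

/-- The random points `y 0, y 1, …` form a Poisson process with intensity measure `μ`: the number
of points in a measurable set `B` is Poisson with parameter `μ B` (almost surely infinite if
`μ B = ∞`), and the numbers of points in disjoint measurable sets are independent. -/
structure IsPoissonProcess {Ω E : Type*} [MeasurableSpace Ω] [MeasurableSpace E]
    (y : ℕ → Ω → E) (μ : Measure E) (P : Measure Ω) : Prop where
  measurable : ∀ i, Measurable (y i)
  law_of_finite : ∀ B, MeasurableSet B → μ B ≠ ∞ →
    P.map (pointCount y B) = (poissonMeasure (μ B).toNNReal).map (fun n : ℕ => (n : ℝ≥0∞))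
  eq_top_of_infinite : ∀ B, MeasurableSet B → μ B = ∞ → ∀ᵐ ω ∂P, pointCount y B ω = ∞
  indep : ∀ (n : ℕ) (B : Fin n → Set E), (∀ k, MeasurableSet (B k)) →
    Pairwise (Function.onFun Disjoint B) → iIndepFun (fun k => pointCount y (B k)) P

/-! ### Max-stable and Fréchet random variables -/

/-- `Z ∼ MS(α, ν)`: the random vector `Z` is distributed as the coordinatewise supremum of the
points of a Poisson process on `E₀` whose intensity is the exponent measure of `(α, ν)`. -/
def IsMS {d : ℕ} {N : Seminorm ℝ (Fin d → ℝ)} {Ω : Type*} [MeasurableSpace Ω]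
    (α : ℝ) (ν : Measure (posSphere N)) (Z : Ω → Fin d → ℝ) (P : Measure Ω) : Prop :=
  ∃ (Ω' : Type) (_ : MeasurableSpace Ω') (P' : Measure Ω') (y : ℕ → Ω' → Fin d → ℝ),
    IsProbabilityMeasure P' ∧
    (∀ i ω, y i ω ∈ E0 d) ∧
    IsPoissonProcess y (exponentMeasure α ν) P' ∧
    IdentDistrib Z (fun ω j => ⨆ i, y i ω j) P P'

/-- `Y` has the Fréchet distribution `F(α)`, with c.d.f. `exp(-x^{-α})` for `x > 0` and `0` for
`x ≤ 0`. -/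
def IsFrechet {Ω : Type*} [MeasurableSpace Ω] (α : ℝ) (Y : Ω → ℝ) (P : Measure Ω) : Prop :=
  AEMeasurable Y P ∧
    ∀ x : ℝ, P.real {ω | Y ω ≤ x} = if 0 < x then Real.exp (-(x ^ (-α))) else 0

/-! ### Distances between distributions of random vectors -/

/-- The Kolmogorov distance, `sup_{z ∈ E₀*} |F_X(z) - F_Y(z)|`. -/
def kolmogorovDist {d : ℕ} {Ω₁ Ω₂ : Type*} [MeasurableSpace Ω₁] [MeasurableSpace Ω₂]
    (X : Ω₁ → Fin d → ℝ) (P₁ : Measure Ω₁) (Y : Ω₂ → Fin d → ℝ) (P₂ : Measure Ω₂) : ℝ :=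
  ⨆ z : E0star d, |P₁.real {ω | ∀ j, X ω j ≤ (z : Fin d → ℝ) j} -
    P₂.real {ω | ∀ j, Y ω j ≤ (z : Fin d → ℝ) j}|

/-- Functions that are `1`-Lipschitz on the orthant for the `ℓ¹` norm (their values outside of the
orthant are irrelevant). -/
def lipOne (d : ℕ) : Set ((Fin d → ℝ) → ℝ) :=
  {h | ∀ x ∈ orthant d, ∀ y ∈ orthant d, |h x - h y| ≤ ∑ j, |x j - y j|}

/-- Functions that are moreover continuously differentiable on the orthant. -/
def smoothLipOne (d : ℕ) : Set ((Fin d → ℝ) → ℝ) :=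
  {h | ContDiffOn ℝ 1 h (orthant d)} ∩ lipOne d

/-- The distance `sup_{h ∈ H} |E h(X) - E h(Y)|`, with values in `[0, ∞]`. -/
def testDist {d : ℕ} {Ω₁ Ω₂ : Type*} [MeasurableSpace Ω₁] [MeasurableSpace Ω₂]
    (H : Set ((Fin d → ℝ) → ℝ)) (X : Ω₁ → Fin d → ℝ) (P₁ : Measure Ω₁)
    (Y : Ω₂ → Fin d → ℝ) (P₂ : Measure Ω₂) : ℝ≥0∞ :=
  ⨆ h ∈ H, ENNReal.ofReal |(∫ ω, h (X ω) ∂P₁) - ∫ ω, h (Y ω) ∂P₂|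

/-- The Wasserstein distance. -/
def wassersteinDist {d : ℕ} {Ω₁ Ω₂ : Type*} [MeasurableSpace Ω₁] [MeasurableSpace Ω₂]
    (X : Ω₁ → Fin d → ℝ) (P₁ : Measure Ω₁) (Y : Ω₂ → Fin d → ℝ) (P₂ : Measure Ω₂) : ℝ≥0∞ :=
  testDist (lipOne d) X P₁ Y P₂

/-- The smooth Wasserstein distance. -/
def smoothWassersteinDist {d : ℕ} {Ω₁ Ω₂ : Type*} [MeasurableSpace Ω₁] [MeasurableSpace Ω₂]
    (X : Ω₁ → Fin d → ℝ) (P₁ : Measure Ω₁) (Y : Ω₂ → Fin d → ℝ) (P₂ : Measure Ω₂) : ℝ≥0∞ :=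
  testDist (smoothLipOne d) X P₁ Y P₂

/-! ### The constants -/

/-- The integrand `|log y^j| P(Y^{α₂/α₁} ∧ Y ≤ y^j)`. -/
def integrandK {d : ℕ} {Ω : Type*} [MeasurableSpace Ω] (α₁ α₂ : ℝ) (Y : Ω → ℝ) (P : Measure Ω)
    (j : Fin d) (y : Fin d → ℝ) : ℝ :=
  |Real.log (y j)| * P.real {ω | min (Y ω ^ (α₂ / α₁)) (Y ω) ≤ y j}

/-- The integrand `(1 ∨ y^j) |log y^j| P(Y^{α₂/α₁} ∧ Y ≤ y^j)`. -/
def integrandW {d : ℕ} {Ω : Type*} [MeasurableSpace Ω] (α₁ α₂ : ℝ) (Y : Ω → ℝ) (P : Measure Ω)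
    (j : Fin d) (y : Fin d → ℝ) : ℝ :=
  max 1 (y j) * |Real.log (y j)| * P.real {ω | min (Y ω ^ (α₂ / α₁)) (Y ω) ≤ y j}

/-- The constant `C^K`. -/
def constK {d : ℕ} {N : Seminorm ℝ (Fin d → ℝ)} {Ω : Type*} [MeasurableSpace Ω]
    (α₁ α₂ : ℝ) (ν : Measure (posSphere N)) (Y : Ω → ℝ) (P : Measure Ω) : ℝ :=
  d + ∑ j : Fin d, ∫ y in E0 d, integrandK α₁ α₂ Y P j y ∂(exponentMeasure α₁ ν)

/-- The constant `C^W`. -/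
def constW {d : ℕ} {N : Seminorm ℝ (Fin d → ℝ)} {Ω : Type*} [MeasurableSpace Ω]
    (α₁ α₂ : ℝ) (ν : Measure (posSphere N)) (Y : Ω → ℝ) (P : Measure Ω) : ℝ :=
  d * Real.Gamma (1 - 1 / α₁) +
    ∑ j : Fin d, ∫ y in E0 d, integrandW α₁ α₂ Y P j y ∂(exponentMeasure α₁ ν)

end MaxStable

end

noncomputable section

namespace MaxStable

open Filter Topology

/-! ### Measures on the half-line -/

/-! Everything rests on one coupling: `Z₂` has the law of the coordinatewise power `Z₁ ^ (α₁ / α₂)`.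
Indeed a maximum of Poisson points is `≤ z` iff no point exceeds `z` in some coordinate, so `P(Z ≤
z) = exp(-μ_α {y | ∃ j, z j < y j})`. Both exponent measures are images of the same `ρ_1 ⊗ ν`, so
the exceedance mass of `μ_{α₂}` at `z` is that of `μ_{α₁}` at `z ^ (α₂ / α₁)`
(`exponentMeasure_exceed_scaling`, `IsMS.cdf`, `IsMS.map_rpow_eq`).

Kolmogorov: compare the distribution function of `Z₁` at `z` and at `z ^ β`, `β = α₂ / α₁`. A union
bound reduces this to the Fréchet marginals, where `|e^{-t} - e^{-t^β}| ≤ β - 1`. The term `d` of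
`C^K` alone suffices.

Wasserstein: with `s = α₁ / α₂`, the cost `|z - z^s|` is at most `(1 - s) (1 ∨ z) |log z|`. The
Fréchet law has density `e^{-x^{-α₁}} = P(Y ≤ x)` with respect to `ρ_{α₁}`, the marginal of `μ_{α₁}`
on `(0, ∞)`, and `P(Y ≤ x) ≤ P(Y^β ∧ Y ≤ x)`. Hence the mean cost is dominated by the integrals in
`C^W`. They converge because that probability decays faster than any power at `0`, while the tail of
`ρ_{α₁}` controls the growth at infinity. -/

lemma restrict_Ioi_zero_ext {m₁ m₂ : Measure ℝ}
    (h : ∀ x > 0, m₁ (Ioi x) = m₂ (Ioi x)) (hfin : ∀ x > 0, m₁ (Ioi x) ≠ ∞) :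
    m₁.restrict (Ioi 0) = m₂.restrict (Ioi 0) := by
  have hU : (Ioi (0 : ℝ)) = ⋃ n : ℕ, Ioi (1 / ((n : ℝ) + 1)) := by
    ext x
    simp only [mem_Ioi, mem_iUnion]
    exact ⟨fun hx => exists_nat_one_div_lt hx,
      fun ⟨n, hn⟩ => lt_trans (by positivity) hn⟩
  -- The measures may be infinite near `0`, so uniqueness on the π-system of rays is applied on each
  -- `(1/(n+1), ∞)`, where they are finite.
  rw [hU, Measure.restrict_iUnion_congr]
  intro n
  set ε : ℝ := 1 / ((n : ℝ) + 1) with hε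
  have hε0 : 0 < ε := by positivity
  have : IsFiniteMeasure (m₁.restrict (Ioi ε)) := isFiniteMeasure_restrict.2 (hfin ε hε0)
  refine ext_of_generate_finite _
    ((BorelSpace.measurable_eq (α := ℝ)).trans (borel_eq_generateFrom_Ioi ℝ))
    isPiSystem_Ioi ?_ (by simpa using h ε hε0)
  rintro _ ⟨a, rfl⟩
  rw [Measure.restrict_apply measurableSet_Ioi, Measure.restrict_apply measurableSet_Ioi,
    Ioi_inter_Ioi]
  exact h _ (lt_sup_of_lt_right hε0)

lemma measurable_rho_density (α : ℝ) :
    Measurable fun r : ℝ => ENNReal.ofReal (α * r ^ (-(α + 1))) := by fun_prop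

instance (α : ℝ) : SigmaFinite (rho α) := by unfold rho; infer_instance

lemma rho_restrict (α : ℝ) : (rho α).restrict (Ioi 0) = rho α := by
  rw [rho, restrict_withDensity measurableSet_Ioi, Measure.restrict_restrict measurableSet_Ioi,
    inter_self]

lemma ae_rho_pos (α : ℝ) : ∀ᵐ r ∂(rho α), 0 < r := by
  rw [← rho_restrict]
  exact ae_restrict_mem measurableSet_Ioi

lemma lintegral_rho_Ioi {α x : ℝ} (hx : 0 ≤ x) (f : ℝ → ℝ≥0∞) (hf : Measurable f) :
    ∫⁻ r in Ioi x, f r ∂(rho α) = ∫⁻ r in Ioi x, ENNReal.ofReal (α * r ^ (-(α + 1))) * f r := by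
  rw [rho, restrict_withDensity measurableSet_Ioi, Measure.restrict_restrict measurableSet_Ioi,
    Ioi_inter_Ioi, sup_eq_left.2 hx,
    lintegral_withDensity_eq_lintegral_mul _ (measurable_rho_density α) hf]
  rfl

/-! ### The Fréchet law and its density with respect to `rho α` -/

lemma hasDerivAt_exp_neg_rpow {α x : ℝ} (hx : 0 < x) :
    HasDerivAt (fun r : ℝ => Real.exp (-(r ^ (-α))))
      (α * x ^ (-(α + 1)) * Real.exp (-(x ^ (-α)))) x := by
  have h : HasDerivAt (fun r : ℝ => Real.exp (-(r ^ (-α))))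
      (Real.exp (-(x ^ (-α))) * -(-α * x ^ (-α - 1))) x :=
    ((Real.hasDerivAt_rpow_const (p := -α) (Or.inl hx.ne')).neg).exp
  convert h using 1
  rw [show -α - 1 = -(α + 1) by ring]
  ring

/-- The Fréchet law with exponent `α`, through its density with respect to `rho α`. -/
def frechetLaw (α : ℝ) : Measure ℝ :=
  (rho α).withDensity fun r => ENNReal.ofReal (Real.exp (-(r ^ (-α))))

lemma rho_Ioi {α x : ℝ} (hα : 0 < α) (hx : 0 < x) :
    rho α (Ioi x) = ENNReal.ofReal (x ^ (-α)) := by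
  have h := lintegral_rho_Ioi (α := α) hx.le (fun _ => 1) measurable_const
  have hi : IntegrableOn (fun r : ℝ => α * r ^ (-(α + 1))) (Ioi x) :=
    (integrableOn_Ioi_rpow_of_lt (by linarith) hx).const_mul α
  simp only [lintegral_const, Measure.restrict_apply MeasurableSet.univ, univ_inter, one_mul,
    mul_one] at h
  rw [h, ← ofReal_integral_eq_lintegral_ofReal hi, integral_const_mul,
    integral_Ioi_rpow_of_lt (by linarith) hx]
  · congr 1
    rw [show -(α + 1) + 1 = -α by ring]
    field_simp
  · filter_upwards [ae_restrict_mem measurableSet_Ioi] with r hr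
    have : 0 < r := hx.trans hr
    positivity

lemma frechetLaw_Ioi {α x : ℝ} (hα : 0 < α) (hx : 0 < x) :
    frechetLaw α (Ioi x) = ENNReal.ofReal (1 - Real.exp (-(x ^ (-α)))) := by
  have hd : ∀ y ∈ Ici x, HasDerivAt (fun r : ℝ => Real.exp (-(r ^ (-α))))
      (α * y ^ (-(α + 1)) * Real.exp (-(y ^ (-α)))) y :=
    fun y hy => hasDerivAt_exp_neg_rpow (hx.trans_le hy)
  have hnn : ∀ y ∈ Ioi x, 0 ≤ α * y ^ (-(α + 1)) * Real.exp (-(y ^ (-α))) := by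
    intro y hy
    have : 0 < y := hx.trans hy
    positivity
  have ht : Tendsto (fun r : ℝ => Real.exp (-(r ^ (-α)))) atTop (𝓝 1) := by
    have := (tendsto_rpow_neg_atTop hα).neg
    rw [neg_zero] at this
    simpa using this.rexp
  rw [frechetLaw, withDensity_apply _ measurableSet_Ioi, lintegral_rho_Ioi hx.le _ (by fun_prop),
    ← integral_Ioi_of_hasDerivAt_of_nonneg' hd hnn ht,
    ofReal_integral_eq_lintegral_ofReal (integrableOn_Ioi_deriv_of_nonneg' hd hnn ht)]
  · refine setLIntegral_congr_fun measurableSet_Ioi fun y hy => ?_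
    have : 0 < y := hx.trans hy
    exact (ENNReal.ofReal_mul (by positivity)).symm
  · filter_upwards [ae_restrict_mem measurableSet_Ioi] with r hr using hnn r hr

lemma tendsto_exp_neg_rpow_nhdsGT_zero {α : ℝ} (hα : 0 < α) :
    Tendsto (fun x : ℝ => Real.exp (-(x ^ (-α)))) (𝓝[>] 0) (𝓝 0) :=
  Real.tendsto_exp_neg_atTop_nhds_zero.comp (tendsto_rpow_neg_nhdsGT_zero (by linarith))

/-- The prescribed distribution function tends to `0` at `0+`, which leaves no mass on the
nonpositive half-line. -/
lemma measure_Iic_zero_eq_zero {α : ℝ} (hα : 0 < α) (m : Measure ℝ) [IsProbabilityMeasure m]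
    (h : ∀ x > 0, m.real (Iic x) = Real.exp (-(x ^ (-α)))) : m (Iic 0) = 0 := by
  have h0 : m.real (Iic 0) ≤ 0 := by
    refine ge_of_tendsto (tendsto_exp_neg_rpow_nhdsGT_zero hα) ?_
    filter_upwards [self_mem_nhdsWithin] with x hx
    rw [← h x hx]
    exact measureReal_mono (Iic_subset_Iic.2 (le_of_lt hx))
  exact (measureReal_eq_zero_iff).1 (le_antisymm h0 measureReal_nonneg)

lemma eq_frechetLaw {α : ℝ} (hα : 0 < α) (m : Measure ℝ) [IsProbabilityMeasure m]
    (h : ∀ x > 0, m.real (Iic x) = Real.exp (-(x ^ (-α)))) : m = frechetLaw α := by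
  have h1 : m.restrict (Ioi 0) = m := by
    refine Measure.restrict_eq_self_of_ae_mem ?_
    rw [ae_iff]
    simpa [Iic_def] using measure_Iic_zero_eq_zero hα m h
  have h2 : (frechetLaw α).restrict (Ioi 0) = frechetLaw α := by
    rw [frechetLaw, restrict_withDensity measurableSet_Ioi, rho_restrict]
  rw [← h1, ← h2]
  refine restrict_Ioi_zero_ext (fun x hx => ?_) (fun x _ => measure_ne_top _ _)
  rw [frechetLaw_Ioi hα hx, ← h x hx, ← compl_Iic, ← probReal_compl_eq_one_sub measurableSet_Iic,
    ofReal_measureReal]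

/-! ### Exponent measures -/

variable {d : ℕ} {N : Seminorm ℝ (Fin d → ℝ)}

lemma measurable_exponentMap (α : ℝ) : Measurable fun p : ℝ × posSphere N => fun j : Fin d =>
    (p.1 * (p.2 : Fin d → ℝ) j) ^ (1 / α) :=
  measurable_pi_lambda _ fun j =>
    have h : Measurable fun p : ℝ × posSphere N => (p.2 : Fin d → ℝ) j :=
      (measurable_pi_apply j).comp (measurable_subtype_coe.comp measurable_snd)
    (measurable_fst.mul h).pow_const _

lemma lintegral_coord_eq_one {ν : Measure (posSphere N)} (hν : MomentConstraints ν) (j : Fin d) :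
    ∫⁻ u, ENNReal.ofReal ((u : Fin d → ℝ) j) ∂ν = 1 := by
  have hi : Integrable (fun u : posSphere N => (u : Fin d → ℝ) j) ν := by
    -- A non-integrable function would have Bochner integral `0`, contradicting the value `1`.
    by_contra h
    have := hν j
    rw [integral_undef h] at this
    norm_num at this
  rw [← ofReal_integral_eq_lintegral_ofReal hi (ae_of_all _ fun u => u.2.1 j), hν j,
    ENNReal.ofReal_one]

/-- For fixed `u` with `u j > 0`, exceedance means `r > x^α / u j`, of `ρ_1`-mass `u j * x^{-α}`;
the moment constraint integrates the factor `u j` to `1`. -/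
lemma exponentMeasure_coord_Ioi {α : ℝ} (hα : 0 < α) {ν : Measure (posSphere N)}
    [IsFiniteMeasure ν] (hν : MomentConstraints ν) (j : Fin d) {x : ℝ} (hx : 0 < x) :
    exponentMeasure α ν {y | x < y j} = ENNReal.ofReal (x ^ (-α)) := by
  have hm : MeasurableSet {y : Fin d → ℝ | x < y j} :=
    measurableSet_lt measurable_const (measurable_pi_apply j)
  rw [exponentMeasure, Measure.map_apply (measurable_exponentMap α) hm,
    Measure.prod_apply_symm (measurable_exponentMap α hm)]
  have key : ∀ u : posSphere N, rho 1 ((fun r => (r, u)) ⁻¹'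
      ((fun p : ℝ × posSphere N => fun j : Fin d => (p.1 * (p.2 : Fin d → ℝ) j) ^ (1 / α)) ⁻¹'
        {y | x < y j})) = ENNReal.ofReal ((u : Fin d → ℝ) j) * ENNReal.ofReal (x ^ (-α)) := by
    intro u
    have hxα : 0 < x ^ α := Real.rpow_pos_of_pos hx α
    rcases (u.2.1 j).eq_or_lt with h0 | hpos
    · rw [← h0, ENNReal.ofReal_zero, zero_mul]
      convert measure_empty (μ := rho 1)
      ext r
      simp only [mem_preimage, mem_ofPred_eq, ← h0, mul_zero, mem_empty_iff_false, iff_false]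
      rw [Real.zero_rpow (by positivity)]
      exact not_lt.2 hx.le
    · rw [← ENNReal.ofReal_mul hpos.le]
      have e : rho 1 (Ioi (x ^ α / (u : Fin d → ℝ) j)) =
          ENNReal.ofReal ((u : Fin d → ℝ) j * x ^ (-α)) := by
        rw [rho_Ioi one_pos (by positivity), Real.rpow_neg_one, inv_div, Real.rpow_neg hx.le,
          div_eq_mul_inv]
      rw [← e]
      refine measure_congr ?_
      filter_upwards [ae_rho_pos 1] with r hr
      refine propext ?_
      change x < (r * (u : Fin d → ℝ) j) ^ (1 / α) ↔ x ^ α / (u : Fin d → ℝ) j < r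
      rw [div_lt_iff₀ hpos, one_div, Real.lt_rpow_inv_iff_of_pos hx.le (by positivity) hα]
  simp_rw [key]
  rw [lintegral_mul_const _
    ((measurable_pi_apply j).comp measurable_subtype_coe).ennreal_ofReal, lintegral_coord_eq_one hν, one_mul]

/-- The restriction is needed because the image may have mass at `0`, when `ν` charges `{u | u j =
0}`. -/
lemma map_exponentMeasure_restrict {α : ℝ} (hα : 0 < α) {ν : Measure (posSphere N)}
    [IsFiniteMeasure ν] (hν : MomentConstraints ν) (j : Fin d) :
    ((exponentMeasure α ν).map fun y => y j).restrict (Ioi 0) = rho α := by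
  rw [← rho_restrict]
  have hmap : ∀ x > 0, ((exponentMeasure α ν).map fun y => y j) (Ioi x) =
      ENNReal.ofReal (x ^ (-α)) := by
    intro x hx
    rw [Measure.map_apply (measurable_pi_apply j) measurableSet_Ioi]
    exact exponentMeasure_coord_Ioi hα hν j hx
  refine restrict_Ioi_zero_ext (fun x hx => ?_) (fun x hx => ?_)
  · rw [hmap x hx, rho_Ioi hα hx]
  · rw [hmap x hx]
    exact ENNReal.ofReal_ne_top

lemma measurableSet_E0 (d : ℕ) : MeasurableSet (E0 d) := by
  have : E0 d = (⋂ j, {x : Fin d → ℝ | 0 ≤ x j}) ∩ {0}ᶜ := by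
    ext x; simp [E0]
  rw [this]
  exact (MeasurableSet.iInter fun j =>
    measurableSet_le measurable_const (measurable_pi_apply j)).inter
    (measurableSet_singleton _).compl

/-- The condition `f 0 = 0` discards the mass at `0`. The integrands of the constants satisfy it
since `Real.log 0 = 0`. -/
lemma lintegral_exponentMeasure_coord {α : ℝ} (hα : 0 < α) {ν : Measure (posSphere N)}
    [IsFiniteMeasure ν] (hν : MomentConstraints ν) (j : Fin d) {f : ℝ → ℝ≥0∞} (hf : Measurable f)
    (hf0 : f 0 = 0) :
    ∫⁻ y in E0 d, f (y j) ∂(exponentMeasure α ν) = ∫⁻ x, f x ∂(rho α) := by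
  have hae : ∀ᵐ y ∂(exponentMeasure α ν), ∀ k, 0 ≤ y k := by
    rw [exponentMeasure, ae_map_iff (measurable_exponentMap α).aemeasurable]
    · have := (Measure.quasiMeasurePreserving_fst (μ := rho 1) (ν := ν)).ae (ae_rho_pos 1)
      filter_upwards [this] with p hp k
      exact Real.rpow_nonneg (mul_nonneg hp.le (p.2.2.1 k)) _
    · exact measurableSet_setOfPred.2 (by measurability)
  rw [← map_exponentMeasure_restrict hα hν j, ← lintegral_indicator measurableSet_Ioi,
    lintegral_map (hf.indicator measurableSet_Ioi) (measurable_pi_apply j),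
    ← lintegral_indicator (measurableSet_E0 d)]
  refine lintegral_congr_ae ?_
  filter_upwards [hae] with y hy
  rcases (hy j).eq_or_lt with h0 | hpos
  · have : f (y j) = 0 := by rw [← h0, hf0]
    have h1 : (Ioi (0 : ℝ)).indicator f (y j) = 0 :=
      indicator_of_notMem (fun h => (mem_Ioi.1 h).ne h0) f
    rw [h1]
    by_cases hm : y ∈ E0 d
    · rw [indicator_of_mem hm, this]
    · rw [indicator_of_notMem hm]
  · have hm : y ∈ E0 d := ⟨hy, fun h => by simp [h] at hpos⟩
    rw [indicator_of_mem hm, indicator_of_mem (show y j ∈ Ioi 0 from hpos)]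

/-- In terms of `(r, u)`, both events say that `z j ^ α₂ < r * u j` for some `j`. -/
lemma exponentMeasure_exceed_scaling {α₁ α₂ : ℝ} (hα₁ : 0 < α₁) (hα₂ : 0 < α₂)
    (ν : Measure (posSphere N)) {z : Fin d → ℝ} (hz : ∀ j, 0 < z j) :
    exponentMeasure α₂ ν {y | ∃ j, z j < y j} =
      exponentMeasure α₁ ν {y | ∃ j, z j ^ (α₂ / α₁) < y j} := by
  have hm : ∀ w : Fin d → ℝ, MeasurableSet {y : Fin d → ℝ | ∃ j, w j < y j} := fun w => by
    simp only [ofPred_exists]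
    exact MeasurableSet.iUnion fun j => measurableSet_lt measurable_const (measurable_pi_apply j)
  rw [exponentMeasure, exponentMeasure, Measure.map_apply (measurable_exponentMap _) (hm z),
    Measure.map_apply (measurable_exponentMap _) (hm _)]
  refine measure_congr ?_
  have := (Measure.quasiMeasurePreserving_fst (μ := rho 1) (ν := ν)).ae (ae_rho_pos 1)
  filter_upwards [this] with p hp
  refine propext (exists_congr fun j => ?_)
  have hpu : 0 ≤ p.1 * (p.2 : Fin d → ℝ) j := mul_nonneg hp.le (p.2.2.1 j)
  simp only
  rw [one_div, one_div, Real.lt_rpow_inv_iff_of_pos (hz j).le hpu hα₂,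
    Real.lt_rpow_inv_iff_of_pos (Real.rpow_nonneg (hz j).le _) hpu hα₁, ← Real.rpow_mul (hz j).le,
    div_mul_cancel₀ _ hα₁.ne']

/-! ### Poisson processes -/

lemma pointCount_eq_zero_iff {Ω E : Type*} {y : ℕ → Ω → E} {B : Set E} {ω : Ω} :
    pointCount y B ω = 0 ↔ ∀ i, y i ω ∉ B := by
  simp [pointCount, ENNReal.tsum_eq_zero, indicator_apply_eq_zero]

lemma finite_of_pointCount_ne_top {Ω E : Type*} {y : ℕ → Ω → E} {B : Set E} {ω : Ω} (h : pointCount y B ω ≠ ∞) :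
    {i | y i ω ∈ B}.Finite := by
  refine (ENNReal.finite_const_le_of_tsum_ne_top h one_ne_zero).subset fun i hi => ?_
  change 1 ≤ B.indicator (fun _ => (1 : ℝ≥0∞)) (y i ω)
  rw [indicator_of_mem (show y i ω ∈ B from hi)]

section Poisson

variable {Ω E : Type*} [MeasurableSpace Ω] [MeasurableSpace E] {y : ℕ → Ω → E} {μ : Measure E}
  {P : Measure Ω}

lemma IsPoissonProcess.measurable_pointCount (hy : IsPoissonProcess y μ P) {B : Set E}
    (hB : MeasurableSet B) : Measurable (pointCount y B) :=
  Measurable.tsum fun i => (measurable_const.indicator hB).comp (hy.measurable i)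

lemma IsPoissonProcess.measure_pointCount_mem (hy : IsPoissonProcess y μ P) {B : Set E}
    (hB : MeasurableSet B) (hfin : μ B ≠ ∞) {S : Set ℝ≥0∞} (hS : MeasurableSet S) :
    P {ω | pointCount y B ω ∈ S} = poissonMeasure (μ B).toNNReal {n | (n : ℝ≥0∞) ∈ S} := by
  have h := congrArg (fun m => m S) (hy.law_of_finite B hB hfin)
  rwa [Measure.map_apply (hy.measurable_pointCount hB) hS,
    Measure.map_apply (by fun_prop) hS] at h

lemma IsPoissonProcess.measure_pointCount_eq_zero (hy : IsPoissonProcess y μ P) {B : Set E}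
    (hB : MeasurableSet B) (hfin : μ B ≠ ∞) :
    P {ω | pointCount y B ω = 0} = ENNReal.ofReal (Real.exp (-(μ B).toReal)) := by
  have h := hy.measure_pointCount_mem hB hfin (measurableSet_singleton 0)
  have h0 : {n : ℕ | (n : ℝ≥0∞) ∈ ({0} : Set ℝ≥0∞)} = {0} := by ext; simp
  rw [h0, poissonMeasure_singleton] at h
  simpa [ENNReal.coe_toNNReal_eq_toReal] using h

lemma IsPoissonProcess.ae_pointCount_ne_top (hy : IsPoissonProcess y μ P) {B : Set E}
    (hB : MeasurableSet B) (hfin : μ B ≠ ∞) : ∀ᵐ ω ∂P, pointCount y B ω ≠ ∞ := by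
  have h := hy.measure_pointCount_mem hB hfin (measurableSet_singleton ∞)
  have h0 : {n : ℕ | (n : ℝ≥0∞) ∈ ({∞} : Set ℝ≥0∞)} = ∅ := by ext; simp
  rw [h0, measure_empty] at h
  rw [ae_iff]
  simpa using h

end Poisson

lemma bddAbove_range_of_finite {f : ℕ → ℝ} {x : ℝ} (h : {i | x < f i}.Finite) :
    BddAbove (range f) := by
  have hb := (h.image f).bddAbove.union (bddAbove_Iic (a := x))
  refine hb.mono ?_
  rintro _ ⟨i, rfl⟩
  by_cases hi : x < f i
  · exact Or.inl ⟨i, hi, rfl⟩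
  · exact Or.inr (not_lt.1 hi)

/-! ### Distribution functions of max-stable vectors -/

variable {Ω : Type*} [MeasurableSpace Ω]

lemma measurableSet_exceed (J : Set (Fin d)) (z : Fin d → ℝ) :
    MeasurableSet {y : Fin d → ℝ | ∃ j ∈ J, z j < y j} := by
  have : {y : Fin d → ℝ | ∃ j ∈ J, z j < y j} = ⋃ j ∈ J, {y | z j < y j} := by ext; simp
  rw [this]
  exact MeasurableSet.biUnion J.to_countable fun j _ =>
    measurableSet_lt measurable_const (measurable_pi_apply j)

lemma measurableSet_below (J : Set (Fin d)) (z : Fin d → ℝ) :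
    MeasurableSet {y : Fin d → ℝ | ∀ j ∈ J, y j ≤ z j} := by
  have : {y : Fin d → ℝ | ∀ j ∈ J, y j ≤ z j} = {y | ∃ j ∈ J, z j < y j}ᶜ := by ext; simp
  rw [this]
  exact (measurableSet_exceed J z).compl

lemma exponentMeasure_exceed_ne_top {α : ℝ} (hα : 0 < α) {ν : Measure (posSphere N)}
    [IsFiniteMeasure ν] (hν : MomentConstraints ν) (J : Set (Fin d)) {z : Fin d → ℝ}
    (hz : ∀ j, 0 < z j) : exponentMeasure α ν {y | ∃ j ∈ J, z j < y j} ≠ ∞ := by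
  refine ne_top_of_le_ne_top (b := ∑ j, exponentMeasure α ν {y | z j < y j}) ?_ ?_
  · refine ENNReal.sum_ne_top.2 fun j _ => ?_
    rw [exponentMeasure_coord_Ioi hα hν j (hz j)]
    exact ENNReal.ofReal_ne_top
  · refine (measure_mono ?_).trans (measure_iUnion_fintype_le _ _)
    rintro y ⟨j, -, hj⟩
    exact mem_iUnion.2 ⟨j, hj⟩

/-- The supremum stays below `z` iff the Poisson process avoids the exceedance set, so this is a
void probability. The set `J` serves both marginals (`{j}`) and the joint law (`univ`). -/
lemma IsMS.cdf {α : ℝ} (hα : 0 < α) {ν : Measure (posSphere N)}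
    [IsFiniteMeasure ν] (hν : MomentConstraints ν) {P : Measure Ω} {Z : Ω → Fin d → ℝ}
    (hZ : IsMS α ν Z P) (J : Set (Fin d)) {z : Fin d → ℝ} (hz : ∀ j, 0 < z j) :
    P.real {ω | ∀ j ∈ J, Z ω j ≤ z j} =
      Real.exp (-(exponentMeasure α ν {y | ∃ j ∈ J, z j < y j}).toReal) := by
  obtain ⟨Ω', _, P', y, _, -, hy, hid⟩ := hZ
  -- A real supremum over an unbounded family takes the default value `0`, so almost sure
  -- boundedness must be proved: finitely many points exceed `z j`.
  have hbdd : ∀ᵐ ω ∂P', ∀ j, BddAbove (range fun i => y i ω j) := by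
    refine ae_all_iff.2 fun j => ?_
    have hfin : exponentMeasure α ν {y | z j < y j} ≠ ∞ := by
      rw [exponentMeasure_coord_Ioi hα hν j (hz j)]
      exact ENNReal.ofReal_ne_top
    filter_upwards [hy.ae_pointCount_ne_top
      (measurableSet_lt measurable_const (measurable_pi_apply j)) hfin] with ω hω
    exact bddAbove_range_of_finite (finite_of_pointCount_ne_top hω)
  have h1 := hid.measure_mem_eq (measurableSet_below J z)
  have h2 : P' ((fun ω j => ⨆ i, y i ω j) ⁻¹' {y : Fin d → ℝ | ∀ j ∈ J, y j ≤ z j}) =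
      P' {ω | pointCount y {y | ∃ j ∈ J, z j < y j} ω = 0} := by
    refine measure_congr ?_
    filter_upwards [hbdd] with ω hω
    refine propext ?_
    change (∀ j ∈ J, ⨆ i, y i ω j ≤ z j) ↔ pointCount y {y | ∃ j ∈ J, z j < y j} ω = 0
    rw [pointCount_eq_zero_iff]
    constructor
    · rintro h i ⟨j, hj, hlt⟩
      exact absurd ((le_ciSup (hω j) i).trans (h j hj)) (not_le.2 hlt)
    · intro h j hj
      exact ciSup_le fun i => not_lt.1 fun hlt => h i ⟨j, hj, hlt⟩
  rw [h2, hy.measure_pointCount_eq_zero (measurableSet_exceed J z)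
    (exponentMeasure_exceed_ne_top hα hν J hz)] at h1
  rw [measureReal_def]
  change (P (Z ⁻¹' {y : Fin d → ℝ | ∀ j ∈ J, y j ≤ z j})).toReal = _
  rw [h1, ENNReal.toReal_ofReal (Real.exp_pos _).le]

lemma IsMS.aemeasurable {α : ℝ} {ν : Measure (posSphere N)} {P : Measure Ω} {Z : Ω → Fin d → ℝ}
    (hZ : IsMS α ν Z P) : AEMeasurable Z P := by
  obtain ⟨_, _, _, _, _, -, -, hid⟩ := hZ
  exact hid.aemeasurable_fst

lemma IsMS.aemeasurable_coord {α : ℝ} {ν : Measure (posSphere N)} {P : Measure Ω}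
    {Z : Ω → Fin d → ℝ} (hZ : IsMS α ν Z P) (j : Fin d) : AEMeasurable (fun ω => Z ω j) P :=
  (measurable_pi_apply j).comp_aemeasurable hZ.aemeasurable

section Law

variable {α : ℝ} {ν : Measure (posSphere N)} [IsFiniteMeasure ν] {P : Measure Ω}
  {Z : Ω → Fin d → ℝ}

lemma IsMS.marginal_cdf (hα : 0 < α) (hν : MomentConstraints ν) (hZ : IsMS α ν Z P) (j : Fin d)
    {x : ℝ} (hx : 0 < x) : P.real {ω | Z ω j ≤ x} = Real.exp (-(x ^ (-α))) := by
  have h := hZ.cdf hα hν {j} (z := fun _ => x) (fun _ => hx)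
  simp only [mem_singleton_iff, forall_eq, exists_eq_left] at h
  rwa [exponentMeasure_coord_Ioi hα hν j hx,
    ENNReal.toReal_ofReal (Real.rpow_nonneg hx.le _)] at h

lemma IsMS.map_coord_real_Iic (hα : 0 < α) (hν : MomentConstraints ν) (hZ : IsMS α ν Z P)
    (j : Fin d) {x : ℝ} (hx : 0 < x) :
    (P.map fun ω => Z ω j).real (Iic x) = Real.exp (-(x ^ (-α))) := by
  rw [measureReal_def, Measure.map_apply_of_aemeasurable (hZ.aemeasurable_coord j)
    measurableSet_Iic]
  exact hZ.marginal_cdf hα hν j hx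

lemma IsMS.map_coord [IsProbabilityMeasure P] (hα : 0 < α) (hν : MomentConstraints ν)
    (hZ : IsMS α ν Z P) (j : Fin d) : (P.map fun ω => Z ω j) = frechetLaw α :=
  have := Measure.isProbabilityMeasure_map (hZ.aemeasurable_coord j)
  eq_frechetLaw hα _ fun _ hx => hZ.map_coord_real_Iic hα hν j hx

lemma IsMS.measure_coord_nonpos [IsProbabilityMeasure P] (hα : 0 < α) (hν : MomentConstraints ν)
    (hZ : IsMS α ν Z P) (j : Fin d) : P {ω | Z ω j ≤ 0} = 0 := by
  have := Measure.isProbabilityMeasure_map (hZ.aemeasurable_coord j)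
  have h := measure_Iic_zero_eq_zero hα _ fun _ hx => hZ.map_coord_real_Iic hα hν j hx
  rwa [Measure.map_apply_of_aemeasurable (hZ.aemeasurable_coord j) measurableSet_Iic] at h

lemma IsMS.ae_pos [IsProbabilityMeasure P] (hα : 0 < α) (hν : MomentConstraints ν)
    (hZ : IsMS α ν Z P) : ∀ᵐ ω ∂P, ∀ j, 0 < Z ω j := by
  refine ae_all_iff.2 fun j => ae_iff.2 ?_
  simpa using hZ.measure_coord_nonpos hα hν j

end Law

/-- Lower orthants form a generating π-system; those with a nonpositive corner coordinate are null
for both measures. -/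
lemma ext_of_cdf_pos {m₁ m₂ : Measure (Fin d → ℝ)} [IsProbabilityMeasure m₁]
    [IsProbabilityMeasure m₂] (h₁ : ∀ᵐ y ∂m₁, ∀ j, 0 < y j) (h₂ : ∀ᵐ y ∂m₂, ∀ j, 0 < y j)
    (h : ∀ z : Fin d → ℝ, (∀ j, 0 < z j) → m₁ {y | ∀ j, y j ≤ z j} = m₂ {y | ∀ j, y j ≤ z j}) :
    m₁ = m₂ := by
  have hspan : IsCountablySpanning (range (Iic : ℝ → Set ℝ)) :=
    ⟨fun n : ℕ => Iic (n : ℝ), fun n => ⟨n, rfl⟩, by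
      ext x
      simpa using exists_nat_ge x⟩
  refine ext_of_generate_finite _ (generateFrom_eq_pi (C := fun _ : Fin d => range Iic)
    (fun _ => ((BorelSpace.measurable_eq (α := ℝ)).trans (borel_eq_generateFrom_Iic ℝ)).symm)
    fun _ => hspan).symm (IsPiSystem.pi fun _ => isPiSystem_Iic) ?_ (by simp)
  rintro _ ⟨s, hs, rfl⟩
  choose z hz using fun j => hs j (mem_univ j)
  have hset : univ.pi s = {y | ∀ j, y j ≤ z j} := by
    ext y
    simp [Set.mem_pi, ← hz]
  rw [hset]
  by_cases hpos : ∀ j, 0 < z j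
  · exact h z hpos
  · obtain ⟨j, hj⟩ := not_forall.1 hpos
    have hnull : ∀ m : Measure (Fin d → ℝ), (∀ᵐ y ∂m, ∀ j, 0 < y j) →
        m {y | ∀ j, y j ≤ z j} = 0 := fun m hm => by
      refine measure_mono_null ?_ (ae_iff.1 hm)
      intro y hy hy'
      exact hj ((hy' j).trans_le (hy j))
    rw [hnull _ h₁, hnull _ h₂]

/-- If `Z₁ ∼ MS(α₁, ν)`, then `Z₁ ^ (α₁ / α₂) ∼ MS(α₂, ν)`. -/
lemma IsMS.map_rpow_eq {α₁ α₂ : ℝ} (hα₁ : 0 < α₁) (hα₂ : 0 < α₂) {ν : Measure (posSphere N)}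
    [IsFiniteMeasure ν] (hν : MomentConstraints ν) {Ω₁ Ω₂ : Type*} [MeasurableSpace Ω₁]
    [MeasurableSpace Ω₂] {P₁ : Measure Ω₁} {P₂ : Measure Ω₂} [IsProbabilityMeasure P₁]
    [IsProbabilityMeasure P₂] {Z₁ : Ω₁ → Fin d → ℝ} {Z₂ : Ω₂ → Fin d → ℝ}
    (hZ₁ : IsMS α₁ ν Z₁ P₁) (hZ₂ : IsMS α₂ ν Z₂ P₂) :
    P₂.map Z₂ = P₁.map fun ω j => Z₁ ω j ^ (α₁ / α₂) := by
  have hm₁ : AEMeasurable (fun ω j => Z₁ ω j ^ (α₁ / α₂)) P₁ :=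
    aemeasurable_pi_lambda _ fun j => (hZ₁.aemeasurable_coord j).pow_const _
  have := Measure.isProbabilityMeasure_map hm₁
  have := Measure.isProbabilityMeasure_map hZ₂.aemeasurable
  have hpm : MeasurableSet {y : Fin d → ℝ | ∀ j, 0 < y j} := by
    simp only [ofPred_forall]
    exact MeasurableSet.iInter fun j => measurableSet_lt measurable_const (measurable_pi_apply j)
  have hbm : ∀ z : Fin d → ℝ, MeasurableSet {y : Fin d → ℝ | ∀ j, y j ≤ z j} := fun z => by
    simpa using measurableSet_below univ z
  have hpos := hZ₁.ae_pos hα₁ hν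
  refine ext_of_cdf_pos ?_ ?_ fun z hz => ?_
  · rw [ae_map_iff hZ₂.aemeasurable hpm]
    exact hZ₂.ae_pos hα₂ hν
  · rw [ae_map_iff hm₁ hpm]
    filter_upwards [hpos] with ω hω j using Real.rpow_pos_of_pos (hω j) _
  · have hz' : ∀ j, 0 < z j ^ (α₂ / α₁) := fun j => Real.rpow_pos_of_pos (hz j) _
    have e₁ := hZ₁.cdf hα₁ hν univ hz'
    have e₂ := hZ₂.cdf hα₂ hν univ hz
    simp only [mem_univ, true_and, forall_const] at e₁ e₂
    rw [exponentMeasure_exceed_scaling hα₁ hα₂ ν hz, ← e₁] at e₂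
    rw [Measure.map_apply_of_aemeasurable hZ₂.aemeasurable (hbm z),
      Measure.map_apply_of_aemeasurable hm₁ (hbm z)]
    refine ((measureReal_eq_measureReal_iff).1 e₂).trans (measure_congr ?_)
    filter_upwards [hpos] with ω hω
    refine propext (forall_congr' fun j => ?_)
    change _ ↔ Z₁ ω j ^ (α₁ / α₂) ≤ z j
    rw [← inv_div, Real.le_rpow_inv_iff_of_pos (hω j).le (hz j).le (by positivity)]

/-! ### Elementary inequalities -/

lemma mul_abs_log_le_exp {w : ℝ} (hw : 0 < w) : w * |Real.log w| ≤ Real.exp w := by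
  rcases le_total w 1 with h | h
  · have h1 := Real.abs_log_mul_self_lt w hw h
    rw [abs_mul, abs_of_pos hw] at h1
    linarith [Real.one_le_exp hw.le]
  · rw [abs_of_nonneg (Real.log_nonneg h)]
    -- Write `e^{w/2} = e^{w/2-1} * e` and use `e^{w/2-1} ≥ w/2` and `e ≥ 2`.
    have h1 : w ≤ Real.exp (w / 2) := by
      have h2 := Real.add_one_le_exp (w / 2 - 1)
      have h3 : Real.exp (w / 2) = Real.exp (w / 2 - 1) * Real.exp 1 := by
        rw [← Real.exp_add]; ring_nf
      have h4 := Real.add_one_le_exp 1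
      rw [h3]
      nlinarith
    have h5 : Real.exp w = Real.exp (w / 2) * Real.exp (w / 2) := by
      rw [← Real.exp_add]; ring_nf
    rw [h5]
    exact mul_le_mul h1 ((Real.log_le_self hw.le).trans h1) (Real.log_nonneg h)
      (Real.exp_pos _).le

/-- Mean value inequality in the exponent `s ∈ [1, β]`. With `w = t^s` the derivative is at most
`e^{-w} w |log w| ≤ 1` in absolute value, because `|log t| ≤ s |log t| = |log w|`. -/
lemma abs_exp_neg_sub_exp_neg_rpow_le {t β : ℝ} (ht : 0 < t) (hβ : 1 ≤ β) :
    |Real.exp (-t) - Real.exp (-(t ^ β))| ≤ β - 1 := by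
  have hd : ∀ s ∈ Icc 1 β, HasDerivWithinAt (fun s : ℝ => Real.exp (-(t ^ s)))
      (Real.exp (-(t ^ s)) * -(t ^ s * Real.log t)) (Icc 1 β) s := fun s _ =>
    ((Real.hasStrictDerivAt_const_rpow ht s).hasDerivAt.neg.exp).hasDerivWithinAt
  have hb : ∀ s ∈ Icc 1 β, ‖Real.exp (-(t ^ s)) * -(t ^ s * Real.log t)‖ ≤ 1 := by
    intro s hs
    have hw : 0 < t ^ s := Real.rpow_pos_of_pos ht s
    rw [Real.norm_eq_abs, abs_mul, abs_neg, abs_mul, abs_of_pos hw, Real.abs_exp, Real.exp_neg,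
      inv_mul_le_iff₀ (Real.exp_pos _), mul_one]
    refine le_trans (mul_le_mul_of_nonneg_left ?_ hw.le) (mul_abs_log_le_exp hw)
    rw [Real.log_rpow ht, abs_mul, abs_of_nonneg (zero_le_one.trans hs.1 : 0 ≤ s)]
    exact le_mul_of_one_le_left (abs_nonneg _) hs.1
  have h := (convex_Icc 1 β).norm_image_sub_le_of_norm_hasDerivWithin_le hd hb
    (right_mem_Icc.2 hβ) (left_mem_Icc.2 hβ)
  simpa [Real.norm_eq_abs, abs_sub_comm 1 β, abs_of_nonneg (sub_nonneg.2 hβ)] using h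

/-- Mean value inequality in the exponent again, with `z^u ≤ 1 ∨ z` for `u ∈ [0, 1]`. -/
lemma abs_sub_rpow_le {z s : ℝ} (hz : 0 < z) (hs0 : 0 ≤ s) (hs1 : s ≤ 1) :
    |z - z ^ s| ≤ (1 - s) * (max 1 z * |Real.log z|) := by
  have hd : ∀ u ∈ Icc s 1, HasDerivWithinAt (fun u : ℝ => z ^ u) (z ^ u * Real.log z)
      (Icc s 1) u := fun u _ =>
    (Real.hasStrictDerivAt_const_rpow hz u).hasDerivAt.hasDerivWithinAt
  have hb : ∀ u ∈ Icc s 1, ‖z ^ u * Real.log z‖ ≤ max 1 z * |Real.log z| := by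
    intro u hu
    rw [Real.norm_eq_abs, abs_mul, abs_of_pos (Real.rpow_pos_of_pos hz u)]
    refine mul_le_mul_of_nonneg_right ?_ (abs_nonneg _)
    rcases le_total z 1 with h | h
    · exact (Real.rpow_le_one hz.le h (hs0.trans hu.1)).trans (le_max_left _ _)
    · exact (Real.rpow_le_self_of_one_le h hu.2).trans (le_max_right _ _)
  have h := (convex_Icc s 1).norm_image_sub_le_of_norm_hasDerivWithin_le hd hb
    (left_mem_Icc.2 hs1) (right_mem_Icc.2 hs1)
  rw [Real.rpow_one, Real.norm_eq_abs, Real.norm_eq_abs, abs_of_nonneg (sub_nonneg.2 hs1)] at h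
  rwa [mul_comm]

lemma sub_one_le_inv_add_inv_mul {a b : ℝ} (ha : 0 < a) (hab : a < b) :
    b / a - 1 ≤ (1 / a + 1 / b) * |a - b| := by
  have hb := ha.trans hab
  rw [abs_sub_comm, abs_of_pos (sub_pos.2 hab)]
  -- The right-hand side splits into two nonnegative terms, one for each of the two distances.
  have : (1 / a + 1 / b) * (b - a) = (b / a - 1) + (1 - a / b) := by field_simp
  rw [this]
  have : a / b ≤ 1 := (div_le_one hb).2 hab.le
  linarith

lemma one_sub_le_inv_add_inv_mul {a b : ℝ} (ha : 0 < a) (hab : a < b) :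
    1 - a / b ≤ (1 / a + 1 / b) * |a - b| := by
  have hb := ha.trans hab
  rw [abs_sub_comm, abs_of_pos (sub_pos.2 hab)]
  have : (1 / a + 1 / b) * (b - a) = (b / a - 1) + (1 - a / b) := by field_simp
  rw [this]
  have : 1 ≤ b / a := (one_le_div ha).2 hab.le
  linarith

lemma exp_neg_le_factorial_div {w : ℝ} (hw : 0 < w) (n : ℕ) :
    Real.exp (-w) ≤ n.factorial / w ^ n := by
  rw [Real.exp_neg, le_div_iff₀ (by positivity), inv_mul_le_iff₀ (Real.exp_pos w), mul_comm]
  have h := Real.pow_div_factorial_le_exp w hw.le n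
  rwa [div_le_iff₀ (by positivity), mul_comm] at h

/-! ### Integrability of the integrands -/

section Integrability

variable {Ω : Type*} [MeasurableSpace Ω] {α₁ α₂ : ℝ} {Y : Ω → ℝ} {P : Measure Ω}
  [IsProbabilityMeasure P]

lemma IsFrechet.ae_pos (hY : IsFrechet α₁ Y P) : ∀ᵐ ω ∂P, 0 < Y ω := by
  have h := hY.2 0
  rw [if_neg (lt_irrefl _), measureReal_eq_zero_iff] at h
  rw [ae_iff]
  simpa using h

lemma IsFrechet.exp_neg_le (hY : IsFrechet α₁ Y P) {x : ℝ} (hx : 0 < x) :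
    Real.exp (-(x ^ (-α₁))) ≤ P.real {ω | min (Y ω ^ (α₂ / α₁)) (Y ω) ≤ x} := by
  have h := hY.2 x
  rw [if_pos hx] at h
  rw [← h]
  exact measureReal_mono fun ω (hω : Y ω ≤ x) => mem_ofPred_eq.mpr ((min_le_right _ _).trans hω)

/-- For `x ≤ 1`, either alternative `Y^β ≤ x` or `Y ≤ x` forces `Y ≤ x^{1/β}`, where `β = α₂ / α₁`.
-/
lemma IsFrechet.prob_min_le (hα₁ : 0 < α₁) (hα : α₁ ≤ α₂) (hY : IsFrechet α₁ Y P) {x : ℝ}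
    (hx : 0 < x) (hx1 : x ≤ 1) :
    P.real {ω | min (Y ω ^ (α₂ / α₁)) (Y ω) ≤ x} ≤ Real.exp (-(x ^ (-(α₁ ^ 2 / α₂)))) := by
  have hα₂ : 0 < α₂ := hα₁.trans_le hα
  have hβ : 1 ≤ α₂ / α₁ := (one_le_div hα₁).2 hα
  have hz : 0 < x ^ (α₂ / α₁)⁻¹ := Real.rpow_pos_of_pos hx _
  have h := hY.2 (x ^ (α₂ / α₁)⁻¹)
  rw [if_pos hz, ← Real.rpow_mul hx.le] at h
  have e : (α₂ / α₁)⁻¹ * -α₁ = -(α₁ ^ 2 / α₂) := by field_simp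
  rw [e] at h
  rw [← h]
  refine ENNReal.toReal_mono (measure_ne_top _ _) (measure_mono_ae ?_)
  filter_upwards [hY.ae_pos] with ω hω hmin
  change Y ω ≤ _
  rcases min_le_iff.1 (show min _ _ ≤ x from hmin) with h1 | h1
  · rwa [Real.le_rpow_inv_iff_of_pos hω.le hx.le (by positivity)]
  · refine h1.trans ?_
    conv_lhs => rw [← Real.rpow_one x]
    exact Real.rpow_le_rpow_of_exponent_ge hx hx1 (inv_le_one_of_one_le₀ hβ)

lemma measurable_prob_le (X : Ω → ℝ) : Measurable fun x : ℝ => P.real {ω | X ω ≤ x} :=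
  Monotone.measurable fun _ _ h => measureReal_mono fun _ hω => le_trans hω h

lemma integrable_rho_iff {α : ℝ} (hα : 0 < α) {f : ℝ → ℝ} :
    Integrable f (rho α) ↔ IntegrableOn (fun x => f x * (α * x ^ (-(α + 1)))) (Ioi 0) := by
  rw [rho, integrable_withDensity_iff (measurable_rho_density α) (by simp)]
  refine integrableOn_congr_fun (fun x hx => ?_) measurableSet_Ioi
  have : 0 < x := hx
  rw [ENNReal.toReal_ofReal (by positivity)]

/-- Near `0` the probability beats every power of `x`; at infinity it is bounded by `1`, and `κ <
α₁` leaves room for the logarithm. It is used with `w = 1`, `κ = 0` and with `w = 1 ∨ x`, `κ = 1`.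
-/
lemma IsFrechet.integrable_weight_mul (hα₁ : 0 < α₁) (hα : α₁ ≤ α₂) (hY : IsFrechet α₁ Y P)
    {w : ℝ → ℝ} (hw : Measurable w) {κ : ℝ} (hκ : κ < α₁) (hw0 : ∀ x, 0 ≤ w x)
    (hw1 : ∀ x, 0 < x → x ≤ 1 → w x ≤ 1) (hwκ : ∀ x, 1 ≤ x → w x ≤ x ^ κ) :
    Integrable (fun x => w x * |Real.log x| * P.real {ω | min (Y ω ^ (α₂ / α₁)) (Y ω) ≤ x})
      (rho α₁) := by
  have hα₂ : 0 < α₂ := hα₁.trans_le hα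
  set q : ℝ → ℝ := fun x => P.real {ω | min (Y ω ^ (α₂ / α₁)) (Y ω) ≤ x} with hq
  have hqm : Measurable q := measurable_prob_le _
  have hq0 : ∀ x, 0 ≤ q x := fun x => measureReal_nonneg
  have hq1 : ∀ x, q x ≤ 1 := fun x => measureReal_le_one
  have hm : Measurable fun x => w x * |Real.log x| * q x * (α₁ * x ^ (-(α₁ + 1))) := by fun_prop
  rw [integrable_rho_iff hα₁, ← Ioc_union_Ioi_eq_Ioi zero_le_one]
  refine IntegrableOn.union ?_ ?_
  -- The power `n` must absorb `x^{-1}`, bounding the logarithm, and `x^{-(α₁+1)}` from the density: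
  -- `α₁ + 2` in total.
  · obtain ⟨n, hn⟩ := exists_nat_ge ((α₁ + 2) / (α₁ ^ 2 / α₂))
    have hγ : 0 < α₁ ^ 2 / α₂ := by positivity
    rw [div_le_iff₀ hγ] at hn
    refine Measure.integrableOn_of_bounded (M := n.factorial * α₁) (by simp)
      hm.aestronglyMeasurable ?_
    filter_upwards [ae_restrict_mem measurableSet_Ioc] with x hx
    have hx0 : 0 < x := hx.1
    have hlog : |Real.log x| ≤ x ^ (-1 : ℝ) := by
      have h1 := Real.abs_log_mul_self_lt x hx0 hx.2
      rw [abs_mul, abs_of_pos hx0] at h1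
      rw [Real.rpow_neg_one, ← one_div, le_div_iff₀ hx0]
      exact h1.le
    have hqx : q x ≤ n.factorial * x ^ ((α₁ ^ 2 / α₂) * n) := by
      refine (hY.prob_min_le hα₁ hα hx0 hx.2).trans
        ((exp_neg_le_factorial_div (Real.rpow_pos_of_pos hx0 _) n).trans_eq ?_)
      rw [Real.rpow_neg hx0.le, inv_pow, div_inv_eq_mul, ← Real.rpow_natCast,
        ← Real.rpow_mul hx0.le]
    have hpow : 0 < x ^ (-(α₁ + 1)) := Real.rpow_pos_of_pos hx0 _
    rw [Real.norm_of_nonneg (by have := hw0 x; have := hq0 x; positivity)]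
    calc w x * |Real.log x| * q x * (α₁ * x ^ (-(α₁ + 1)))
        ≤ 1 * x ^ (-1 : ℝ) * (n.factorial * x ^ ((α₁ ^ 2 / α₂) * n)) *
          (α₁ * x ^ (-(α₁ + 1))) := by
          have := hw0 x
          have := hq0 x
          gcongr
          exact hw1 x hx0 hx.2
      _ = n.factorial * α₁ * x ^ (-1 + (α₁ ^ 2 / α₂) * n + -(α₁ + 1)) := by
          rw [Real.rpow_add hx0, Real.rpow_add hx0]; ring
      _ ≤ n.factorial * α₁ * 1 := by
          gcongr
          exact Real.rpow_le_one hx0.le hx.2 (by nlinarith)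
      _ = n.factorial * α₁ := mul_one _
  -- Half of the gap `α₁ - κ` pays for the logarithm, the other half for integrability.
  · set ε := (α₁ - κ) / 2 with hε
    have hε0 : 0 < ε := by rw [hε]; linarith
    have hdom : IntegrableOn (fun x : ℝ => α₁ / ε * x ^ (κ + ε + -(α₁ + 1))) (Ioi 1) :=
      (integrableOn_Ioi_rpow_of_lt (by rw [hε]; linarith) one_pos).const_mul _
    refine Integrable.mono' hdom hm.aestronglyMeasurable ?_
    filter_upwards [ae_restrict_mem measurableSet_Ioi] with x hx
    have hx1 : 1 ≤ x := le_of_lt hx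
    have hx0 : 0 < x := one_pos.trans_le hx1
    have hpow : 0 < x ^ (-(α₁ + 1)) := Real.rpow_pos_of_pos hx0 _
    have hlog : |Real.log x| ≤ x ^ ε / ε := by
      rw [abs_of_nonneg (Real.log_nonneg hx1)]
      exact Real.log_le_rpow_div hx0.le hε0
    rw [Real.norm_of_nonneg (by have := hw0 x; have := hq0 x; positivity)]
    calc w x * |Real.log x| * q x * (α₁ * x ^ (-(α₁ + 1)))
        ≤ x ^ κ * (x ^ ε / ε) * 1 * (α₁ * x ^ (-(α₁ + 1))) := by
          have := hw0 x
          have := hq0 x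
          gcongr
          · exact hwκ x hx1
          · exact hq1 x
      _ = α₁ / ε * x ^ (κ + ε + -(α₁ + 1)) := by
          rw [Real.rpow_add hx0, Real.rpow_add hx0]; ring

end Integrability

/-! ### Test functions -/

section Lipschitz

variable {h : (Fin d → ℝ) → ℝ}

lemma posPart_mem_orthant (x : Fin d → ℝ) : (fun j => max (x j) 0) ∈ orthant d :=
  fun _ => le_max_right _ _

/-- A test function is unconstrained off the orthant. Precomposing with the positive part makes it
continuous everywhere without changing it on the orthant, which gives measurability. -/
lemma continuous_lipOne_posPart (hh : h ∈ lipOne d) :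
    Continuous fun x : Fin d → ℝ => h fun j => max (x j) 0 := by
  have hL : LipschitzWith d fun x : Fin d → ℝ => h fun j => max (x j) 0 := by
    refine LipschitzWith.of_dist_le_mul fun x y => ?_
    rw [Real.dist_eq]
    refine (hh _ (posPart_mem_orthant x) _ (posPart_mem_orthant y)).trans ?_
    calc ∑ j, |max (x j) 0 - max (y j) 0| ≤ ∑ _j : Fin d, dist x y :=
          Finset.sum_le_sum fun j _ =>
            (abs_max_sub_max_le_abs _ _ _).trans (dist_le_pi_dist x y j)
      _ = ((d : NNReal) : ℝ) * dist x y := by simp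
  exact hL.continuous

variable {Ω : Type*} [MeasurableSpace Ω] {P : Measure Ω} {X : Ω → Fin d → ℝ}

lemma aestronglyMeasurable_lipOne (hh : h ∈ lipOne d) (hX : AEMeasurable X P)
    (hpos : ∀ᵐ ω ∂P, ∀ j, 0 < X ω j) : AEStronglyMeasurable (fun ω => h (X ω)) P := by
  refine ((continuous_lipOne_posPart hh).measurable.comp_aemeasurable
    hX).aestronglyMeasurable.congr ?_
  filter_upwards [hpos] with ω hω
  refine congrArg h (funext fun j => max_eq_left (hω j).le)

lemma integrable_lipOne [IsFiniteMeasure P] (hh : h ∈ lipOne d) (hX : AEMeasurable X P)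
    (hpos : ∀ᵐ ω ∂P, ∀ j, 0 < X ω j) (hint : ∀ j, Integrable (fun ω => X ω j) P) :
    Integrable (fun ω => h (X ω)) P := by
  have hdom : Integrable (fun ω => |h 0| + ∑ j, X ω j) P :=
    (integrable_const _).add (integrable_finsetSum Finset.univ fun j _ => hint j)
  refine Integrable.mono' hdom (aestronglyMeasurable_lipOne hh hX hpos) ?_
  filter_upwards [hpos] with ω hω
  have h1 := hh (X ω) (fun j => (hω j).le) 0 (fun _ => le_rfl)
  have h2 : ∑ j, |X ω j - (0 : Fin d → ℝ) j| = ∑ j, X ω j :=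
    Finset.sum_congr rfl fun j _ => by rw [Pi.zero_apply, sub_zero, abs_of_pos (hω j)]
  rw [h2] at h1
  have h3 : |h (X ω)| ≤ |h 0| + |h (X ω) - h 0| := by
    have := abs_add_le (h 0) (h (X ω) - h 0)
    rwa [add_sub_cancel] at this
  exact h3.trans (by gcongr)

end Lipschitz

/-! ### Comparison of two max-stable laws with the same angular measure -/

lemma integrableOn_exponentMeasure_coord {α : ℝ} (hα : 0 < α) {ν : Measure (posSphere N)}
    [IsFiniteMeasure ν] (hν : MomentConstraints ν) (j : Fin d) {f : ℝ → ℝ} (hf : Measurable f)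
    (hf0 : f 0 = 0) (hint : Integrable f (rho α)) :
    IntegrableOn (fun y => f (y j)) (E0 d) (exponentMeasure α ν) := by
  refine ⟨(hf.comp (measurable_pi_apply j)).aestronglyMeasurable, ?_⟩
  have h := lintegral_exponentMeasure_coord hα hν j (f := fun x => ‖f x‖ₑ) hf.enorm (by simp [hf0])
  rw [HasFiniteIntegral, h]
  exact hint.2

/-- A point of `⋂ A j` outside `⋂ B j` lies in some `A j \ B j`, and nesting makes that probability
`0` or the exact difference. The direction of nesting may vary with `j`. -/
lemma abs_measureReal_sub_le {Ω : Type*} [MeasurableSpace Ω] (P : Measure Ω)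
    [IsProbabilityMeasure P] (A B : Fin d → Set Ω) (hA : ∀ j, NullMeasurableSet (A j) P)
    (hB : ∀ j, NullMeasurableSet (B j) P) (hAB : ∀ j, A j ⊆ B j ∨ B j ⊆ A j) :
    |P.real (⋂ j, A j) - P.real (⋂ j, B j)| ≤ ∑ j, |P.real (A j) - P.real (B j)| := by
  have key : ∀ A B : Fin d → Set Ω, (∀ j, NullMeasurableSet (A j) P) →
      (∀ j, NullMeasurableSet (B j) P) → (∀ j, A j ⊆ B j ∨ B j ⊆ A j) →
      P.real (⋂ j, A j) - P.real (⋂ j, B j) ≤ ∑ j, |P.real (A j) - P.real (B j)| := by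
    intro A B hA hB hAB
    have hsub : (⋂ j, A j) ⊆ (⋂ j, B j) ∪ ⋃ j, (A j \ B j) := by
      intro ω hω
      by_cases hω' : ω ∈ ⋂ j, B j
      · exact Or.inl hω'
      · obtain ⟨j, hj⟩ := not_forall.1 (fun h => hω' (mem_iInter.2 h))
        exact Or.inr (mem_iUnion.2 ⟨j, mem_iInter.1 hω j, hj⟩)
    have h1 : P.real (⋂ j, A j) ≤ P.real (⋂ j, B j) + ∑ j, P.real (A j \ B j) :=
      (measureReal_mono hsub).trans ((measureReal_union_le _ _).trans
        (add_le_add_right (measureReal_iUnion_fintype_le _) _))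
    have h2 : ∀ j, P.real (A j \ B j) ≤ |P.real (A j) - P.real (B j)| := by
      intro j
      rcases hAB j with h | h
      · rw [sdiff_eq_empty.2 h, measureReal_empty]
        exact abs_nonneg _
      · have e := measureReal_inter_add_sdiff₀ (μ := P) (s := A j) (hB j)
        rw [inter_eq_right.2 h] at e
        exact le_trans (by linarith) (le_abs_self _)
    linarith [Finset.sum_le_sum fun j (_ : j ∈ Finset.univ) => h2 j]
  refine abs_sub_le_iff.2 ⟨key A B hA hB hAB, ?_⟩
  simp_rw [abs_sub_comm (P.real (A _))]
  exact key B A hB hA fun j => (hAB j).symm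

section Nonneg

variable {ν : Measure (posSphere N)} {α₁ α₂ : ℝ} {Ω : Type*} [MeasurableSpace Ω] {P : Measure Ω}
  {Y : Ω → ℝ}

lemma integrandK_nonneg (j : Fin d) (y : Fin d → ℝ) : 0 ≤ integrandK α₁ α₂ Y P j y := by
  unfold integrandK; positivity

lemma integrandW_nonneg (j : Fin d) (y : Fin d → ℝ) : 0 ≤ integrandW α₁ α₂ Y P j y := by
  unfold integrandW; positivity

lemma le_constK : (d : ℝ) ≤ constK α₁ α₂ ν Y P :=
  le_add_of_nonneg_right
    (Finset.sum_nonneg fun j _ => integral_nonneg fun y => integrandK_nonneg j y)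

lemma integral_integrandW_nonneg (j : Fin d) :
    0 ≤ ∫ y in E0 d, integrandW α₁ α₂ Y P j y ∂(exponentMeasure α₁ ν) :=
  integral_nonneg fun y => integrandW_nonneg j y

end Nonneg

section Comparison

variable {ν : Measure (posSphere N)} [IsFiniteMeasure ν] {α₁ α₂ : ℝ}
  {Ω₁ Ω₂ Ω₀ : Type*} [MeasurableSpace Ω₁] [MeasurableSpace Ω₂] [MeasurableSpace Ω₀]
  {P₁ : Measure Ω₁} {P₂ : Measure Ω₂} {P₀ : Measure Ω₀}
  [IsProbabilityMeasure P₁]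
  {Z₁ : Ω₁ → Fin d → ℝ} {Z₂ : Ω₂ → Fin d → ℝ} {Y : Ω₀ → ℝ}

lemma abs_cdf_sub_le (hα₁ : 0 < α₁) (hα : α₁ < α₂) (hν : MomentConstraints ν)
    (hZ₁ : IsMS α₁ ν Z₁ P₁) (hZ₂ : IsMS α₂ ν Z₂ P₂) {z : Fin d → ℝ} (hz : ∀ j, 0 < z j) :
    |P₁.real {ω | ∀ j, Z₁ ω j ≤ z j} - P₂.real {ω | ∀ j, Z₂ ω j ≤ z j}| ≤
      d * (α₂ / α₁ - 1) := by
  have hα₂ := hα₁.trans hα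
  have hz' : ∀ j, 0 < z j ^ (α₂ / α₁) := fun j => Real.rpow_pos_of_pos (hz j) _
  have e₁ := hZ₁.cdf hα₁ hν univ hz'
  have e₂ := hZ₂.cdf hα₂ hν univ hz
  simp only [mem_univ, true_and, forall_const] at e₁ e₂
  rw [exponentMeasure_exceed_scaling hα₁ hα₂ ν hz, ← e₁] at e₂
  -- Both probabilities now concern `Z₁`, at the corners `z` and `z ^ (α₂ / α₁)`, so the events are
  -- nested in each coordinate.
  rw [e₂, ofPred_forall, ofPred_forall]
  have hm : ∀ w j, NullMeasurableSet {ω | Z₁ ω j ≤ w} P₁ := fun w j =>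
    nullMeasurableSet_le (hZ₁.aemeasurable_coord j) aemeasurable_const
  refine (abs_measureReal_sub_le P₁ _ _ (fun j => hm _ j) (fun j => hm _ j) fun j => ?_).trans ?_
  · rcases le_total (z j) (z j ^ (α₂ / α₁)) with h | h
    · exact Or.inl fun ω hω => le_trans hω h
    · exact Or.inr fun ω hω => le_trans hω h
  · calc _ ≤ ∑ _j : Fin d, (α₂ / α₁ - 1) := Finset.sum_le_sum fun j _ => ?_
      _ = d * (α₂ / α₁ - 1) := by rw [Fin.sum_const, nsmul_eq_mul]
    rw [hZ₁.marginal_cdf hα₁ hν j (hz j), hZ₁.marginal_cdf hα₁ hν j (hz' j)]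
    have e : (z j ^ (α₂ / α₁)) ^ (-α₁) = (z j ^ (-α₁)) ^ (α₂ / α₁) := by
      rw [← Real.rpow_mul (hz j).le, ← Real.rpow_mul (hz j).le, mul_comm]
    rw [e]
    exact abs_exp_neg_sub_exp_neg_rpow_le (Real.rpow_pos_of_pos (hz j) _)
      ((one_le_div hα₁).2 hα.le)

variable [IsProbabilityMeasure P₂] [IsProbabilityMeasure P₀]

lemma integrableOn_integrandK (hα₁ : 0 < α₁) (hα : α₁ ≤ α₂) (hν : MomentConstraints ν)
    (hY : IsFrechet α₁ Y P₀) (j : Fin d) :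
    IntegrableOn (integrandK α₁ α₂ Y P₀ j) (E0 d) (exponentMeasure α₁ ν) := by
  have h := hY.integrable_weight_mul hα₁ hα (w := fun _ => 1) measurable_const hα₁
    (fun _ => zero_le_one) (fun _ _ _ => le_rfl) (fun x _ => by simp)
  have hq := measurable_prob_le (P := P₀) fun ω => min (Y ω ^ (α₂ / α₁)) (Y ω)
  have := integrableOn_exponentMeasure_coord hα₁ hν j (by fun_prop) (by simp) h
  simp only [one_mul] at this
  exact this

lemma integrableOn_integrandW (hα₁ : 1 < α₁) (hα : α₁ ≤ α₂) (hν : MomentConstraints ν)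
    (hY : IsFrechet α₁ Y P₀) (j : Fin d) :
    IntegrableOn (integrandW α₁ α₂ Y P₀ j) (E0 d) (exponentMeasure α₁ ν) := by
  have hα₁' := one_pos.trans hα₁
  have h := hY.integrable_weight_mul hα₁' hα (w := fun x => max 1 x) (by fun_prop) hα₁
    -- The weight `1 ∨ x` grows like `x`, so the growth condition is exactly `1 < α₁`.
    (fun _ => le_max_of_le_left zero_le_one) (fun _ _ hx => by simp [hx])
    (fun x hx => by simp [hx])
  have hq := measurable_prob_le (P := P₀) fun ω => min (Y ω ^ (α₂ / α₁)) (Y ω)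
  exact integrableOn_exponentMeasure_coord hα₁' hν j (by fun_prop) (by simp) h

/-- The logarithmic moments of the marginals of `Z₁` are dominated by the integrals of
`integrandW`. -/
lemma integrable_logMoment (hα₁ : 1 < α₁) (hα : α₁ ≤ α₂) (hν : MomentConstraints ν)
    (hZ₁ : IsMS α₁ ν Z₁ P₁) (hY : IsFrechet α₁ Y P₀) (j : Fin d) :
    Integrable (fun ω => max 1 (Z₁ ω j) * |Real.log (Z₁ ω j)|) P₁ ∧
      ∫ ω, max 1 (Z₁ ω j) * |Real.log (Z₁ ω j)| ∂P₁ ≤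
        ∫ y in E0 d, integrandW α₁ α₂ Y P₀ j y ∂(exponentMeasure α₁ ν) := by
  have hα₁' := one_pos.trans hα₁
  have hi := integrableOn_integrandW (ν := ν) hα₁ hα hν hY j
  have hq := measurable_prob_le (P := P₀) fun ω => min (Y ω ^ (α₂ / α₁)) (Y ω)
  have hwm : Measurable fun x : ℝ => max 1 x * |Real.log x| := by fun_prop
  have hw0 : ∀ x : ℝ, 0 ≤ max 1 x * |Real.log x| := fun x => by positivity
  have hle : ∫⁻ ω, ENNReal.ofReal (max 1 (Z₁ ω j) * |Real.log (Z₁ ω j)|) ∂P₁ ≤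
      ENNReal.ofReal (∫ y in E0 d, integrandW α₁ α₂ Y P₀ j y ∂(exponentMeasure α₁ ν)) := by
    rw [ofReal_integral_eq_lintegral_ofReal hi (ae_of_all _ fun y => integrandW_nonneg j y),
      ← lintegral_map' (f := fun x => ENNReal.ofReal (max 1 x * |Real.log x|))
        (by fun_prop) (hZ₁.aemeasurable_coord j), hZ₁.map_coord hα₁' hν j, frechetLaw,
      lintegral_withDensity_eq_lintegral_mul _ (by fun_prop) (by fun_prop)]
    refine le_of_le_of_eq ?_ (lintegral_exponentMeasure_coord hα₁' hν j (f := fun x =>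
      ENNReal.ofReal (max 1 x * |Real.log x| * P₀.real {ω | min (Y ω ^ (α₂ / α₁)) (Y ω) ≤ x}))
      (by fun_prop) (by simp)).symm
    -- With respect to `rho α₁` the law of `Z₁ j` has density `P(Y ≤ x)`, which is at most `P(Y^β ∧
    -- Y ≤ x)`.
    refine lintegral_mono_ae ?_
    filter_upwards [ae_rho_pos α₁] with x hx
    rw [Pi.mul_apply, ← ENNReal.ofReal_mul (Real.exp_pos _).le, mul_comm]
    exact ENNReal.ofReal_le_ofReal (mul_le_mul_of_nonneg_left (hY.exp_neg_le hx) (hw0 x))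
  have hms : AEStronglyMeasurable (fun ω => max 1 (Z₁ ω j) * |Real.log (Z₁ ω j)|) P₁ :=
    (hwm.comp_aemeasurable (hZ₁.aemeasurable_coord j)).aestronglyMeasurable
  refine ⟨⟨hms, ?_⟩, ?_⟩
  · rw [hasFiniteIntegral_iff_ofReal (ae_of_all _ fun ω => hw0 _)]
    exact hle.trans_lt ENNReal.ofReal_lt_top
  · rw [integral_eq_lintegral_of_nonneg_ae (ae_of_all _ fun ω => hw0 _) hms]
    exact ENNReal.toReal_le_of_le_ofReal (integral_integrandW_nonneg j) hle

/-- Beyond `e` the logarithm is at least `1`; thus the logarithmic moment also yields the first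
moment of `Z₁ j`. -/
lemma le_exp_one_add_logMoment {z : ℝ} :
    z ≤ Real.exp 1 + max 1 z * |Real.log z| := by
  rcases le_total z (Real.exp 1) with h | h
  · exact le_add_of_le_of_nonneg h (by positivity)
  · have h1 : 1 ≤ Real.log z := (Real.le_log_iff_exp_le ((Real.exp_pos 1).trans_le h)).2 h
    have h2 : z ≤ max 1 z * |Real.log z| := by
      calc z ≤ max 1 z * 1 := by rw [mul_one]; exact le_max_right _ _
        _ ≤ _ := by gcongr; exact h1.trans (le_abs_self _)
    linarith [Real.exp_pos 1]

lemma integrable_coord (hα₁ : 1 < α₁) (hα : α₁ ≤ α₂) (hν : MomentConstraints ν)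
    (hZ₁ : IsMS α₁ ν Z₁ P₁) (hY : IsFrechet α₁ Y P₀) (j : Fin d) :
    Integrable (fun ω => Z₁ ω j) P₁ := by
  refine Integrable.mono' ((integrable_const (Real.exp 1)).add
    (integrable_logMoment hα₁ hα hν hZ₁ hY j).1)
    (hZ₁.aemeasurable_coord j).aestronglyMeasurable ?_
  filter_upwards [hZ₁.ae_pos (one_pos.trans hα₁) hν] with ω hω
  rw [Real.norm_of_nonneg (hω j).le]
  exact le_exp_one_add_logMoment

lemma integrable_rpow_coord (hα₁ : 1 < α₁) (hα : α₁ ≤ α₂) (hν : MomentConstraints ν)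
    (hZ₁ : IsMS α₁ ν Z₁ P₁) (hY : IsFrechet α₁ Y P₀) (j : Fin d) :
    Integrable (fun ω => Z₁ ω j ^ (α₁ / α₂)) P₁ := by
  have hα₁' := one_pos.trans hα₁
  have hα₂ := hα₁'.trans_le hα
  refine Integrable.mono' ((integrable_const (1 : ℝ)).add
    (integrable_coord hα₁ hα hν hZ₁ hY j))
    ((hZ₁.aemeasurable_coord j).pow_const _).aestronglyMeasurable ?_
  filter_upwards [hZ₁.ae_pos hα₁' hν] with ω hω
  have hz := hω j
  rw [Real.norm_of_nonneg (by positivity)]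
  change _ ≤ 1 + Z₁ ω j
  rcases le_total (Z₁ ω j) 1 with h | h
  · exact le_add_of_le_of_nonneg (Real.rpow_le_one hz.le h (by positivity)) hz.le
  · exact le_add_of_nonneg_of_le zero_le_one
      (Real.rpow_le_self_of_one_le h ((div_le_one hα₂).2 hα))

lemma integrable_lipOne_fst (hα₁ : 1 < α₁) (hα : α₁ ≤ α₂) (hν : MomentConstraints ν)
    (hZ₁ : IsMS α₁ ν Z₁ P₁) (hY : IsFrechet α₁ Y P₀) {h : (Fin d → ℝ) → ℝ} (hh : h ∈ lipOne d) :
    Integrable (fun ω => h (Z₁ ω)) P₁ :=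
  integrable_lipOne hh hZ₁.aemeasurable (hZ₁.ae_pos (one_pos.trans hα₁) hν)
    fun j => integrable_coord hα₁ hα hν hZ₁ hY j

lemma integrable_lipOne_rpow (hα₁ : 1 < α₁) (hα : α₁ ≤ α₂) (hν : MomentConstraints ν)
    (hZ₁ : IsMS α₁ ν Z₁ P₁) (hY : IsFrechet α₁ Y P₀) {h : (Fin d → ℝ) → ℝ} (hh : h ∈ lipOne d) :
    Integrable (fun ω => h fun j => Z₁ ω j ^ (α₁ / α₂)) P₁ := by
  refine integrable_lipOne hh
    (aemeasurable_pi_lambda _ fun j => (hZ₁.aemeasurable_coord j).pow_const _) ?_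
    fun j => integrable_rpow_coord hα₁ hα hν hZ₁ hY j
  filter_upwards [hZ₁.ae_pos (one_pos.trans hα₁) hν] with ω hω j using
    Real.rpow_pos_of_pos (hω j) _

lemma IsMS.identDistrib_rpow (hα₁ : 0 < α₁) (hα₂ : 0 < α₂) (hν : MomentConstraints ν)
    (hZ₁ : IsMS α₁ ν Z₁ P₁) (hZ₂ : IsMS α₂ ν Z₂ P₂) {h : (Fin d → ℝ) → ℝ} (hh : h ∈ lipOne d) :
    IdentDistrib (fun ω => h (Z₂ ω)) (fun ω => h fun j => Z₁ ω j ^ (α₁ / α₂)) P₂ P₁ := by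
  have hid : IdentDistrib Z₂ (fun ω j => Z₁ ω j ^ (α₁ / α₂)) P₂ P₁ :=
    ⟨hZ₂.aemeasurable,
      aemeasurable_pi_lambda _ fun j => (hZ₁.aemeasurable_coord j).pow_const _,
      hZ₁.map_rpow_eq hα₁ hα₂ hν hZ₂⟩
  have h1 := hid.comp (continuous_lipOne_posPart hh).measurable
  have e₂ : ((fun x : Fin d → ℝ => h fun j => max (x j) 0) ∘ Z₂) =ᵐ[P₂] fun ω => h (Z₂ ω) := by
    filter_upwards [hZ₂.ae_pos hα₂ hν] with ω hω
    exact congrArg h (funext fun j => max_eq_left (hω j).le)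
  have e₁ : ((fun x : Fin d → ℝ => h fun j => max (x j) 0) ∘ fun ω j => Z₁ ω j ^ (α₁ / α₂))
      =ᵐ[P₁] fun ω => h fun j => Z₁ ω j ^ (α₁ / α₂) := by
    filter_upwards [hZ₁.ae_pos hα₁ hν] with ω hω
    exact congrArg h (funext fun j => max_eq_left (Real.rpow_nonneg (hω j).le _))
  exact ((IdentDistrib.of_ae_eq h1.aemeasurable_fst e₂).symm.trans h1).trans
    (IdentDistrib.of_ae_eq h1.aemeasurable_snd e₁)

/-- Replace `Z₂` by `Z₁ ^ (α₁ / α₂)` on the space of `Z₁`; the Lipschitz condition then bounds the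
difference by the coordinatewise costs of this coupling. -/
lemma abs_integral_lipOne_sub_le (hα₁ : 1 < α₁) (hα : α₁ ≤ α₂) (hν : MomentConstraints ν)
    (hZ₁ : IsMS α₁ ν Z₁ P₁) (hZ₂ : IsMS α₂ ν Z₂ P₂) (hY : IsFrechet α₁ Y P₀)
    {h : (Fin d → ℝ) → ℝ} (hh : h ∈ lipOne d) :
    |(∫ ω, h (Z₁ ω) ∂P₁) - ∫ ω, h (Z₂ ω) ∂P₂| ≤ (1 - α₁ / α₂) *
      ∑ j : Fin d, ∫ y in E0 d, integrandW α₁ α₂ Y P₀ j y ∂(exponentMeasure α₁ ν) := by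
  have hα₁' := one_pos.trans hα₁
  have hα₂ := hα₁'.trans_le hα
  have hs1 : α₁ / α₂ ≤ 1 := (div_le_one hα₂).2 hα
  have hmom := fun j => integrable_logMoment (ν := ν) hα₁ hα hν hZ₁ hY j
  rw [(hZ₁.identDistrib_rpow hα₁' hα₂ hν hZ₂ hh).integral_eq,
    ← integral_sub (integrable_lipOne_fst hα₁ hα hν hZ₁ hY hh)
      (integrable_lipOne_rpow hα₁ hα hν hZ₁ hY hh)]
  have hsum : Integrable (fun ω => (1 - α₁ / α₂) *
      ∑ j : Fin d, max 1 (Z₁ ω j) * |Real.log (Z₁ ω j)|) P₁ :=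
    (integrable_finsetSum _ fun j _ => (hmom j).1).const_mul _
  rw [← Real.norm_eq_abs]
  refine (norm_integral_le_of_norm_le hsum ?_).trans ?_
  · filter_upwards [hZ₁.ae_pos hα₁' hν] with ω hω
    refine (hh _ (fun j => (hω j).le) _ fun j => Real.rpow_nonneg (hω j).le _).trans ?_
    rw [Finset.mul_sum]
    exact Finset.sum_le_sum fun j _ => abs_sub_rpow_le (hω j) (by positivity) hs1
  · rw [integral_const_mul, integral_finsetSum _ fun j _ => (hmom j).1]
    exact mul_le_mul_of_nonneg_left (Finset.sum_le_sum fun j _ => (hmom j).2)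
      (sub_nonneg.2 hs1)

end Comparison

end MaxStable

end

theorem mainTheorem4 {d : ℕ} (hd : 1 ≤ d)
    (N : Seminorm ℝ (Fin d → ℝ)) (hN : MaxStable.IsReferenceNorm N)
    (ν : Measure (MaxStable.posSphere N)) [IsFiniteMeasure ν]
    (hν : MaxStable.MomentConstraints ν)
    (α₁ α₂ : ℝ) (hα₁ : 0 < α₁) (hα : α₁ < α₂)
    {Ω₁ Ω₂ Ω₀ : Type*} [MeasurableSpace Ω₁] [MeasurableSpace Ω₂] [MeasurableSpace Ω₀]
    (P₁ : Measure Ω₁) (P₂ : Measure Ω₂) (P₀ : Measure Ω₀)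
    [IsProbabilityMeasure P₁] [IsProbabilityMeasure P₂] [IsProbabilityMeasure P₀]
    (Z₁ : Ω₁ → Fin d → ℝ) (hZ₁ : MaxStable.IsMS α₁ ν Z₁ P₁)
    (Z₂ : Ω₂ → Fin d → ℝ) (hZ₂ : MaxStable.IsMS α₂ ν Z₂ P₂)
    (Y : Ω₀ → ℝ) (hY : MaxStable.IsFrechet α₁ Y P₀) :
    -- Kolmogorov distance: the integrals in the constant are finite, and the bound holds
    ((∀ j : Fin d, IntegrableOn (MaxStable.integrandK α₁ α₂ Y P₀ j) (MaxStable.E0 d)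
        (MaxStable.exponentMeasure α₁ ν)) ∧
      MaxStable.kolmogorovDist Z₁ P₁ Z₂ P₂ ≤
        MaxStable.constK α₁ α₂ ν Y P₀ * (1 / α₁ + 1 / α₂) * |α₁ - α₂|) ∧
    -- Wasserstein distances
    (1 < α₁ → 1 < α₂ →
      (∀ j : Fin d, IntegrableOn (MaxStable.integrandW α₁ α₂ Y P₀ j) (MaxStable.E0 d)
        (MaxStable.exponentMeasure α₁ ν)) ∧
      0 < MaxStable.constW α₁ α₂ ν Y P₀ ∧
      (∀ h ∈ MaxStable.lipOne d,
        Integrable (fun ω => h (Z₁ ω)) P₁ ∧ Integrable (fun ω => h (Z₂ ω)) P₂) ∧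
      MaxStable.wassersteinDist Z₁ P₁ Z₂ P₂ ≤
        ENNReal.ofReal (MaxStable.constW α₁ α₂ ν Y P₀ * (1 / α₁ + 1 / α₂) * |α₁ - α₂|) ∧
      MaxStable.smoothWassersteinDist Z₁ P₁ Z₂ P₂ ≤
        ENNReal.ofReal (MaxStable.constW α₁ α₂ ν Y P₀ * (1 / α₁ + 1 / α₂) * |α₁ - α₂|)) := by
  have hα₂ : 0 < α₂ := hα₁.trans hα
  have hconv : 0 ≤ (1 / α₁ + 1 / α₂) * |α₁ - α₂| := by positivity
  refine ⟨⟨fun j => MaxStable.integrableOn_integrandK hα₁ hα.le hν hY j, ?_⟩, fun h₁ _ => ?_⟩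
  · have : Nonempty (MaxStable.E0star d) := ⟨⟨fun _ => 1, fun _ => one_pos⟩⟩
    refine ciSup_le fun z => (MaxStable.abs_cdf_sub_le hα₁ hα hν hZ₁ hZ₂ z.2).trans ?_
    rw [mul_assoc]
    refine (mul_le_mul_of_nonneg_left (MaxStable.sub_one_le_inv_add_inv_mul hα₁ hα)
      d.cast_nonneg).trans ?_
    exact mul_le_mul_of_nonneg_right MaxStable.le_constK hconv
  -- The Gamma term is not needed for the distance bound; together with `d ≥ 1` it gives the strict
  -- positivity of `C^W`.
  · have hΓ : 0 < d * Real.Gamma (1 - 1 / α₁) := by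
      have h0 : 0 < 1 - 1 / α₁ := sub_pos.2 ((div_lt_one hα₁).2 h₁)
      have := Real.Gamma_pos_of_pos h0
      have : (0 : ℝ) < d := by exact_mod_cast hd
      positivity
    have hI : 0 ≤ ∑ j : Fin d, ∫ y in MaxStable.E0 d, MaxStable.integrandW α₁ α₂ Y P₀ j y
        ∂(MaxStable.exponentMeasure α₁ ν) :=
      Finset.sum_nonneg fun j _ => MaxStable.integral_integrandW_nonneg j
    have hW : MaxStable.wassersteinDist Z₁ P₁ Z₂ P₂ ≤
        ENNReal.ofReal (MaxStable.constW α₁ α₂ ν Y P₀ * (1 / α₁ + 1 / α₂) * |α₁ - α₂|) := by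
      refine iSup₂_le fun h hh => ENNReal.ofReal_le_ofReal ?_
      refine (MaxStable.abs_integral_lipOne_sub_le h₁ hα.le hν hZ₁ hZ₂ hY hh).trans ?_
      rw [mul_assoc, mul_comm]
      exact mul_le_mul (le_add_of_nonneg_left hΓ.le)
        (MaxStable.one_sub_le_inv_add_inv_mul hα₁ hα)
        (sub_nonneg.2 ((div_le_one hα₂).2 hα.le)) (add_nonneg hΓ.le hI)
    refine ⟨fun j => MaxStable.integrableOn_integrandW h₁ hα.le hν hY j,
      add_pos_of_pos_of_nonneg hΓ hI, fun h hh => ⟨?_, ?_⟩, hW, le_trans ?_ hW⟩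
    · exact MaxStable.integrable_lipOne_fst h₁ hα.le hν hZ₁ hY hh
    · exact (hZ₁.identDistrib_rpow hα₁ hα₂ hν hZ₂ hh).integrable_iff.2
        (MaxStable.integrable_lipOne_rpow h₁ hα.le hν hZ₁ hY hh)
    · exact biSup_mono fun h hh => hh.2
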